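/- Let $\mathsf k$ be a field, $R=\mathsf k[x_1,\dots,x_r]$, and let $S=\mathsf k_{DP}[X_1,\dots,X_r]$ be the divided power ring, on which $R$ acts by contraction: $x^{a}\circ X^{[b]}=X^{[b-a]}$ if $a\le b$ componentwise, and $0$ otherwise. Let $j\ge 5$, let $0\ne f\in S_j$ be homogeneous of degree $j$, let $I_B=\operatorname{Ann} f=\{h\in R: h\circ f=0\}$, and let $B=R/I_B$, a graded Gorenstein algebra of socle degree $j$. Write $H(0)=H(B)$ for its Hilbert function, and assume that $I_B$ is generated by homogeneous elements of degrees at most $j-3$. Let $H(1)=(0,1,0,\dots,0,1,0)$ be the sequence of length $j+1$ with value $1$ in degrees $1$ and $j-2$ and value $0$ in all other degrees. For a local Artinian Gorenstein (AG) $\mathsf k$-algebra $A$ with maximal ideal $\mathfrak m$, residue field $A/\mathfrak m=\mathsf k$ and socle degree $j_A=\max\{i:\mathfrak m^i\neq0\}$, let $A^*=\bigoplus_i\mathfrak m^i/\mathfrak m^{i+1}$ be the associated graded algebra and let $C_A(a)\subset A^*$ be the ideal with homogeneous components $$C_A(a)_i=\bigl(\mathfrak m^i\cap(0:\mathfrak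 m^{\,j_A+1-a-i})\bigr)\big/\bigl(\mathfrak m^{i+1}\cap(0:\mathfrak m^{\,j_A+1-a-i})\bigr)$$ (where $\mathfrak m^e=A$ for $e\le 0$). Put $Q_A(a)=C_A(a)/C_A(a+1)$ and $H_A(a)_i=\dim_{\mathsf k}Q_A(a)_i$; in particular $Q_A(0)=A^*/C_A(1)$ is an algebra. The symmetric decomposition of $A$ is $\mathcal D(A)=(H_A(0),H_A(1),\dots,H_A(j_A-2))$. Then: 1. There is no local AG algebra $A$ with residue field $\mathsf k$ that is a quotient of $R[w]$, has $Q_A(0)\cong B$ as a $\mathsf k$-algebra, and has complete symmetric decomposition $(H(0),H(1))$, that is, $H_A(0)=H(0)$, $H_A(1)=H(1)$ and $H_A(a)=0$ for $2\le a\le j_A-2$. 2. Nor can $(H(0),H(1))$ be the first part of a longer symmetric decomposition: there is no local AG algebra $A$ with residue field $\mathsf k$ that is a quotient of a polynomial ring over $\mathsf k$ in any finite number of variables, has $Q_A(0)\cong B$ as a $\mathsf k$-algebra, and satisfies $H_A(0)=H(0)$ and $H_A(1)=H(1)$. -/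

import Mathlib

open IsLocalRing

noncomputable section

namespace SymDecomp

/-! ### Macaulay duality: contraction on the divided power ring -/

section Contraction

variable {σ k : Type*} [Field k]

/-- The underlying `k`-space of the divided power ring `k_DP[X_s : s ∈ σ]`: its basis consists of
the divided power monomials `X^[b]`, where `b` runs over the exponent vectors. Only its structure
as a module over the polynomial ring is used. -/
abbrev DividedPower (σ k : Type*) [Field k] : Type _ := (σ →₀ ℕ) →₀ k

/-- `F` is homogeneous of degree `j`: an element of the degree-`j` part of the divided power
ring. -/
def IsForm (F : DividedPower σ k) (j : ℕ) : Prop :=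
  ∀ b ∈ F.support, b.degree = j

/-- Contraction by the monomial `x^a`: the coefficient of `X^[c]` in `x^a ∘ F` is the coefficient
of `X^[a + c]` in `F`; that is, `x^a ∘ X^[b] = X^[b - a]` if `a ≤ b`, and `0` otherwise. -/
def contractMonomial (a : σ →₀ ℕ) : Module.End k (DividedPower σ k) :=
  Finsupp.lcomapDomain (fun c => a + c) (add_right_injective a)

theorem contractMonomial_apply (a : σ →₀ ℕ) (F : DividedPower σ k) (c : σ →₀ ℕ) :
    contractMonomial a F c = F (a + c) := rfl

/-- The contraction action of the polynomial ring on the divided power ring,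
`(h ∘ F) = ∑ₐ hₐ (x^a ∘ F)`. -/
def contract : MvPolynomial σ k →ₐ[k] Module.End k (DividedPower σ k) :=
  AddMonoidAlgebra.lift k (Module.End k (DividedPower σ k)) (σ →₀ ℕ)
    { toFun := fun a => contractMonomial a.toAdd
      map_one' := by
        ext F c
        simp [contractMonomial_apply]
      map_mul' := fun a b => by
        refine LinearMap.ext fun F => Finsupp.ext fun c => ?_
        simp only [Module.End.mul_apply, contractMonomial_apply, toAdd_mul]
        congr 1
        abel }

theorem contract_monomial (a : σ →₀ ℕ) (t : k) (F : DividedPower σ k) :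
    contract (MvPolynomial.monomial a t) F = t • contractMonomial a F := by
  have h : contract (MvPolynomial.monomial a t) = t • contractMonomial (σ := σ) (k := k) a := by
    unfold contract
    exact AddMonoidAlgebra.lift_single _ _ _
  rw [h]; rfl

/-- `Ann F`: the ideal of all polynomials `h` with `h ∘ F = 0`. -/
def annIdeal (F : DividedPower σ k) : Ideal (MvPolynomial σ k) where
  carrier := {h | contract h F = 0}
  add_mem' := fun {g h} hg hh => by
    simp only [Set.mem_ofPred_eq] at hg hh ⊢
    rw [map_add, LinearMap.add_apply, hg, hh, add_zero]
  zero_mem' := by simp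
  smul_mem' := fun g h hh => by
    simp only [Set.mem_ofPred_eq] at hh ⊢
    rw [smul_eq_mul, map_mul, Module.End.mul_apply, hh, map_zero]

/-- The ideal `I` is generated by homogeneous polynomials of degrees at most `d`. -/
def GeneratedInDegreeLE (I : Ideal (MvPolynomial σ k)) (d : ℕ) : Prop :=
  ∃ G : Set (MvPolynomial σ k),
    (∀ g ∈ G, ∃ e ≤ d, g.IsHomogeneous e) ∧ Ideal.span G = I

/-- The Hilbert function of the quotient of the standard graded polynomial ring by a homogeneous
ideal `I`: the dimension of the image of the forms of degree `i`. -/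
def gradedHilbert (I : Ideal (MvPolynomial σ k)) (i : ℕ) : ℕ :=
  Module.finrank k
    (Submodule.map (Ideal.Quotient.mkₐ k I).toLinearMap (MvPolynomial.homogeneousSubmodule σ k i))

end Contraction

/-! ### The symmetric decomposition of a local Artinian Gorenstein algebra -/

section Decomposition

variable (k A : Type*) [Field k] [CommRing A] [Algebra k A] [IsLocalRing A]

/-- The local `k`-algebra `A` is Artinian Gorenstein with residue field `k`: it is Artinian,
`k → A/𝔪` is bijective and the socle `(0 : 𝔪)` is one-dimensional. -/
structure IsArtinianGorenstein : Prop where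
  artinian : IsArtinianRing A
  residue : Function.Bijective (algebraMap k (ResidueField A))
  socle : Module.finrank k (maximalIdeal A).annihilator = 1

/-- The socle degree of `A`: the largest `i` with `𝔪^i ≠ 0`. -/
def socleDegree : ℕ := sSup {i : ℕ | maximalIdeal A ^ i ≠ ⊥}

/-- The associated graded algebra `A* = ⨁ᵢ 𝔪^i / 𝔪^(i+1)`, as the quotient of the Rees algebra
`⨁ᵢ 𝔪^i t^i` by the ideal `𝔪 · ⨁ᵢ 𝔪^i t^i = ⨁ᵢ 𝔪^(i+1) t^i`. -/
def AssocGraded (A : Type*) [CommRing A] [IsLocalRing A] : Type _ :=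
  reesAlgebra (maximalIdeal A) ⧸
    (maximalIdeal A).map (algebraMap A (reesAlgebra (maximalIdeal A)))

instance : CommRing (AssocGraded A) :=
  inferInstanceAs (CommRing (reesAlgebra (maximalIdeal A) ⧸
    (maximalIdeal A).map (algebraMap A (reesAlgebra (maximalIdeal A)))))

instance : Algebra k (AssocGraded A) :=
  inferInstanceAs (Algebra k (reesAlgebra (maximalIdeal A) ⧸
    (maximalIdeal A).map (algebraMap A (reesAlgebra (maximalIdeal A)))))

/-- The projection from the Rees algebra onto `A*`. -/
def reesToGraded : reesAlgebra (maximalIdeal A) →ₐ[k] AssocGraded A :=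
  Ideal.Quotient.mkₐ k
    ((maximalIdeal A).map (algebraMap A (reesAlgebra (maximalIdeal A))))

/-- The `k`-linear map `𝔪^i → A*` that sends `x` to its class in `𝔪^i / 𝔪^(i+1)`, the degree-`i`
part of `A*`. -/
def initialForm (i : ℕ) : ↥(maximalIdeal A ^ i) →ₗ[k] AssocGraded A where
  toFun x := reesToGraded k A
    ⟨Polynomial.monomial i (x : A), reesAlgebra.monomial_mem.mpr x.2⟩
  map_add' x y := by
    rw [← map_add]
    congr 1
    apply Subtype.ext
    exact (Polynomial.monomial i).map_add (x : A) y
  map_smul' c x := by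
    rw [RingHom.id_apply, ← map_smul]
    congr 1
    apply Subtype.ext
    exact (Polynomial.smul_monomial c i (x : A)).symm

/-- `C(a)ᵢ`: the image of `𝔪^i ∩ (0 : 𝔪^(j+1-a-i))` in `𝔪^i / 𝔪^(i+1)`, where `j` is the socle
degree of `A`. For an exponent `≤ 0` the annihilator is `(0 : A) = 0`. -/
def loewyPiece (a i : ℕ) : Submodule k (AssocGraded A) :=
  Submodule.map (initialForm k A i)
    (Submodule.comap ((maximalIdeal A ^ i).subtype.restrictScalars k)
      ((maximalIdeal A ^ (socleDegree A + 1 - a - i)).annihilator.restrictScalars k))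

/-- The ideal `C(a)` of `A*` with homogeneous components `C(a)ᵢ`. -/
def loewyIdeal (a : ℕ) : Ideal (AssocGraded A) :=
  Ideal.span (⋃ i : ℕ, (loewyPiece k A a i : Set (AssocGraded A)))

/-- `Q(0) = A* / C(1)` (as `C(0) = A*`), a `k`-algebra. -/
def QZero : Type _ := AssocGraded A ⧸ loewyIdeal k A 1

instance : CommRing (QZero k A) :=
  inferInstanceAs (CommRing (AssocGraded A ⧸ loewyIdeal k A 1))

instance : Algebra k (QZero k A) :=
  inferInstanceAs (Algebra k (AssocGraded A ⧸ loewyIdeal k A 1))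

/-- `H_A(a)ᵢ`, the dimension of `Q(a)ᵢ = C(a)ᵢ / C(a+1)ᵢ`. -/
def symHilbert (a i : ℕ) : ℕ :=
  Module.finrank k
    (loewyPiece k A a i ⧸ (loewyPiece k A (a + 1) i).submoduleOf (loewyPiece k A a i))

/-- `D` is the complete symmetric decomposition `(H_A(0), H_A(1), …, H_A(j-2))` of `A`. -/
def IsCompleteDecomposition (D : ℕ → ℕ → ℕ) : Prop :=
  ∀ a ≤ socleDegree A - 2, ∀ i, symHilbert k A a i = D a i

/-- The symmetric decomposition of `A` begins with `(D 0, …, D b)`. -/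
def DecompositionStartsWith (b : ℕ) (D : ℕ → ℕ → ℕ) : Prop :=
  ∀ a ≤ b, ∀ i, symHilbert k A a i = D a i

end Decomposition

/-- The sequence `(0, 1, 0, …, 0, 1, 0)` of length `j + 1`, with ones in degrees `1` and
`j - 2`. -/
def hOne (j i : ℕ) : ℕ := if i = 1 ∨ i = j - 2 then 1 else 0

/-- The decomposition `(H₀, H₁)`, continued by zeros. -/
def pairDecomp (H₀ H₁ : ℕ → ℕ) : ℕ → ℕ → ℕ
  | 0 => H₀
  | 1 => H₁
  | _ => 0

end SymDecomp

end

/-! Suppose such an `A` exists, with maximal ideal 𝔪 and socle degree j, and let w ∈ 𝔪 with w𝔪^(j-1)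
= 0 represent a generator of Q(1) in degree 1. The contradiction is that w ∈ 𝔪² + (0 : 𝔪^(j-2)), so
that its class in Q(1) is zero.

Choose coordinates y in 𝔪 adapted to the isomorphism Q(0) ≅ B (`exists_coordinates`): a form h of
degree e lies in Ann f exactly when h(y) vanishes in Q(0) in degree e. For g in Ann f of degree j-3,
the vanishing of H(1) in degree j-3 gives g(y) ∈ 𝔪^(j-2) + (0 : 𝔪²), so w y_i g(y) = 0. Generation
in degrees at most j-3 then makes w kill h(y) for every h in Ann f of degree j-2
(`mul_aeval_eq_zero_of_generated`).

Hence multiplication by w on forms of degree j-2, read in the socle, factors through B. Since B is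
Gorenstein, its degrees 2 and j-2 are dual, so w acts there as q(y) for some quadric q
(`exists_quadric_of_annihilates`).

Thus w - q(y) kills all forms of degree j-2 in y. Modulo elements that multiply harmlessly, 𝔪 is
spanned by the linear forms in y and w, and H(1) = 0 in degree 2 gives w²𝔪^(j-3) = 0. So w - q(y)
kills all of 𝔪^(j-2) (`mem_loewySub_of_generated`).

Of H(1) only the values in degrees 1, 2 and j-3 enter; H(0) serves to identify j as the socle degree
of `A`. -/

open IsLocalRing

noncomputable section

namespace SymDecomp

/-! ### Homogeneous ideals of the Rees algebra, tested on coefficients -/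

section Rees

variable {A : Type*} [CommRing A] {I : Ideal A}

/-- The homogeneous ideal `⨁ᵢ (I^i ∩ Kᵢ) t^i` of the Rees algebra defined by a family of ideals
`Kᵢ` with `I^i K_l ⊆ K_{i+l}`. -/
def reesIdeal (I : Ideal A) (K : ℕ → Ideal A)
    (hK : ∀ i l x y, x ∈ I ^ i → y ∈ K l → x * y ∈ K (i + l)) : Ideal (reesAlgebra I) where
  carrier := {p | ∀ i, (p : Polynomial A).coeff i ∈ K i}
  add_mem' := fun {p q} hp hq i => by simpa using add_mem (hp i) (hq i)
  zero_mem' := fun i => by simp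
  smul_mem' := fun p q hq i => by
    rw [smul_eq_mul, MulMemClass.coe_mul, Polynomial.coeff_mul]
    refine sum_mem fun x hx => ?_
    rw [← Finset.HasAntidiagonal.mem_antidiagonal.1 hx]
    exact hK _ _ _ _ ((mem_reesAlgebra_iff I _).1 p.2 _) (hq _)

/-- The element `x t^i` of the Rees algebra, for `x` in `I^i`. -/
def reesMonomial (i : ℕ) (x : A) (hx : x ∈ I ^ i) : reesAlgebra I :=
  ⟨Polynomial.monomial i x, reesAlgebra.monomial_mem.mpr hx⟩

theorem coeff_reesMonomial (i l : ℕ) (x : A) (hx : x ∈ I ^ i) :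
    (reesMonomial i x hx : Polynomial A).coeff l = if i = l then x else 0 :=
  Polynomial.coeff_monomial

theorem eq_sum_reesMonomial (p : reesAlgebra I) :
    p = ∑ i ∈ (p : Polynomial A).support,
      reesMonomial i ((p : Polynomial A).coeff i) ((mem_reesAlgebra_iff I _).1 p.2 i) := by
  apply Subtype.ext
  rw [AddSubmonoidClass.coe_finsetSum]
  exact (p : Polynomial A).as_sum_support

/-- Makes vanishing in the associated graded ring a condition on coefficients, one degree at a time.
-/
theorem mem_map_algebraMap_reesAlgebra {p : reesAlgebra I} :
    p ∈ I.map (algebraMap A (reesAlgebra I)) ↔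
      ∀ i, (p : Polynomial A).coeff i ∈ I ^ (i + 1) := by
  constructor
  · intro hp
    have hK : ∀ i l x y, x ∈ I ^ i → y ∈ I ^ (l + 1) → x * y ∈ I ^ (i + l + 1) := by
      intro i l x y hx hy
      rw [add_assoc, pow_add]; exact Ideal.mul_mem_mul hx hy
    have : I.map (algebraMap A (reesAlgebra I)) ≤ reesIdeal I (fun i => I ^ (i + 1)) hK := by
      rw [Ideal.map_le_iff_le_comap]
      intro a ha i
      change (Polynomial.C a).coeff i ∈ _
      rw [Polynomial.coeff_C]
      split_ifs with h
      · subst h; simpa using ha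
      · exact zero_mem _
    exact this hp
  · intro hp
    rw [eq_sum_reesMonomial p]
    refine sum_mem fun i _ => ?_
    have key : ∀ x ∈ I * I ^ i, ∃ hx : x ∈ I ^ i,
        reesMonomial i x hx ∈ I.map (algebraMap A (reesAlgebra I)) := by
      intro x hx
      refine Submodule.mul_induction_on hx (fun a ha b hb => ?_) ?_
      · have : reesMonomial i (a * b) (Ideal.mul_mem_left _ a hb) =
            algebraMap A (reesAlgebra I) a * reesMonomial i b hb := by
          apply Subtype.ext
          change Polynomial.monomial i (a * b) = Polynomial.C a * Polynomial.monomial i b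
          rw [Polynomial.C_mul_monomial]
        refine ⟨Ideal.mul_mem_left _ a hb, ?_⟩
        rw [this]
        exact Ideal.mul_mem_right _ _ (Ideal.mem_map_of_mem _ ha)
      · rintro x y ⟨hx, h1⟩ ⟨hy, h2⟩
        have : reesMonomial i (x + y) (add_mem hx hy) =
            reesMonomial i x hx + reesMonomial i y hy :=
          Subtype.ext ((Polynomial.monomial i).map_add x y)
        exact ⟨add_mem hx hy, this ▸ add_mem h1 h2⟩
    exact (key _ (pow_succ' I i ▸ hp i)).2

end Rees

/-! ### The Loewy filtration, transferred from the associated graded ring to ideals of `A` -/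

section Decomposition

variable (A : Type*) [CommRing A] [IsLocalRing A]

/-- The ideal of those `x` in `A` that lie in `𝔪^i ∩ (0 : 𝔪^(j+1-a-i))` modulo `𝔪^(i+1)`. -/
def loewySub (a i : ℕ) : Ideal A :=
  maximalIdeal A ^ (i + 1) ⊔
    (maximalIdeal A ^ i ⊓ (maximalIdeal A ^ (socleDegree A + 1 - a - i)).annihilator)

variable {A}

theorem mem_loewySub {a i : ℕ} {x : A} : x ∈ loewySub A a i ↔
    ∃ s ∈ maximalIdeal A ^ (i + 1), ∃ t ∈ maximalIdeal A ^ i,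
      t ∈ (maximalIdeal A ^ (socleDegree A + 1 - a - i)).annihilator ∧ s + t = x := by
  simp only [loewySub, Submodule.mem_sup, Submodule.mem_inf, and_assoc]

/-- This is why C(a) is an ideal: a factor from 𝔪^i raises the degree by i and lowers the
annihilated power by i. The exponent inequality survives truncated subtraction. -/
theorem mul_mem_loewySub (a i l : ℕ) (x y : A) (hx : x ∈ maximalIdeal A ^ i)
    (hy : y ∈ loewySub A a l) : x * y ∈ loewySub A a (i + l) := by
  obtain ⟨s, hs, t, ht, ht', rfl⟩ := mem_loewySub.1 hy
  refine mem_loewySub.2 ⟨x * s, ?_, x * t, ?_, ?_, (mul_add _ _ _).symm⟩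
  · rw [add_assoc, pow_add]; exact Ideal.mul_mem_mul hx hs
  · rw [pow_add]; exact Ideal.mul_mem_mul hx ht
  · rw [Submodule.mem_annihilator] at ht' ⊢
    intro n hn
    have : x * n ∈ maximalIdeal A ^ (socleDegree A + 1 - a - l) := by
      refine Ideal.pow_le_pow_right ?_ (pow_add (maximalIdeal A) i _ ▸ Ideal.mul_mem_mul hx hn)
      omega
    have := ht' _ this
    simp only [smul_eq_mul] at this ⊢
    linear_combination this

theorem pow_succ_le_loewySub (a i : ℕ) : maximalIdeal A ^ (i + 1) ≤ loewySub A a i := le_sup_left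

theorem loewySub_le_pow (a i : ℕ) : loewySub A a i ≤ maximalIdeal A ^ i :=
  sup_le (Ideal.pow_le_pow_right i.le_succ) inf_le_left

variable (k : Type*) [Field k] [Algebra k A]

theorem reesToGraded_eq_zero {p : reesAlgebra (maximalIdeal A)} :
    reesToGraded k A p = 0 ↔ ∀ i, (p : Polynomial A).coeff i ∈ maximalIdeal A ^ (i + 1) := by
  rw [← mem_map_algebraMap_reesAlgebra]
  exact Ideal.Quotient.eq_zero_iff_mem

theorem initialForm_eq {i : ℕ} (x : ↥(maximalIdeal A ^ i)) :
    initialForm k A i x = reesToGraded k A (reesMonomial i x x.2) := rfl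

theorem initialForm_eq_zero {i : ℕ} {x : ↥(maximalIdeal A ^ i)} :
    initialForm k A i x = 0 ↔ (x : A) ∈ maximalIdeal A ^ (i + 1) := by
  rw [initialForm_eq, reesToGraded_eq_zero]
  constructor
  · intro h
    simpa [coeff_reesMonomial] using h i
  · intro h l
    rw [coeff_reesMonomial]
    split_ifs with hl
    · exact hl ▸ h
    · exact zero_mem _

theorem initialForm_mem_loewyPiece {a i : ℕ} {x : ↥(maximalIdeal A ^ i)} :
    initialForm k A i x ∈ loewyPiece k A a i ↔ (x : A) ∈ loewySub A a i := by
  rw [mem_loewySub]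
  constructor
  · rintro ⟨t, ht, hx⟩
    have : initialForm k A i (x - t) = 0 := by rw [map_sub, hx, sub_self]
    exact ⟨_, (initialForm_eq_zero k).1 this, t, t.2, ht, by simp⟩
  · rintro ⟨s, hs, t, ht, ht', hx⟩
    refine ⟨⟨t, ht⟩, ht', ?_⟩
    rw [← sub_eq_zero, ← map_sub, initialForm_eq_zero]
    have : (t - x : A) = -s := by rw [← hx]; ring
    change (t - x : A) ∈ _
    rw [this]
    exact neg_mem hs

/-- The projection from the Rees algebra onto `Q(0)`. -/
def reesToQZero : reesAlgebra (maximalIdeal A) →ₐ[k] QZero k A :=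
  AlgHom.comp (B := AssocGraded A) (Ideal.Quotient.mkₐ k (loewyIdeal k A 1)) (reesToGraded k A)

theorem reesToGraded_surjective : Function.Surjective (reesToGraded k A) :=
  Ideal.Quotient.mk_surjective

theorem reesToQZero_surjective : Function.Surjective (reesToQZero k (A := A)) :=
  Function.Surjective.comp (g := Ideal.Quotient.mk (loewyIdeal k A 1))
    Ideal.Quotient.mk_surjective (reesToGraded_surjective k)

/-- The generators of C(1) are initial forms, so C(1) is the image of a homogeneous ideal of the
Rees algebra. A preimage differs from p by coefficients in 𝔪^(i+1), which `loewySub` absorbs. -/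
theorem reesToQZero_eq_zero {p : reesAlgebra (maximalIdeal A)} :
    reesToQZero k p = 0 ↔ ∀ i, (p : Polynomial A).coeff i ∈ loewySub A 1 i := by
  have h1 : reesToQZero k p = 0 ↔ reesToGraded k A p ∈ loewyIdeal k A 1 :=
    Ideal.Quotient.eq_zero_iff_mem
  rw [h1]
  constructor
  · intro h
    set T := reesIdeal (maximalIdeal A) (loewySub A 1) (mul_mem_loewySub 1)
    have hle : loewyIdeal k A 1 ≤ T.map (reesToGraded k A).toRingHom := by
      refine Ideal.span_le.2 (Set.iUnion_subset fun i => ?_)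
      rintro _ ⟨x, hx, rfl⟩
      refine Ideal.mem_map_of_mem (reesToGraded k A).toRingHom
        (x := reesMonomial i (x : A) x.2) fun l => ?_
      rw [coeff_reesMonomial]
      split_ifs with hl
      · subst hl
        exact (initialForm_mem_loewyPiece k).1 ⟨x, hx, rfl⟩
      · exact zero_mem _
    obtain ⟨q, hq, hqp⟩ := (Ideal.mem_map_iff_of_surjective (reesToGraded k A).toRingHom
      (reesToGraded_surjective k)).1 (hle h)
    have h0 : reesToGraded k A (p - q) = 0 := by
      rw [map_sub, sub_eq_zero]; exact hqp.symm
    intro i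
    have h2 := pow_succ_le_loewySub 1 i ((reesToGraded_eq_zero k).1 h0 i)
    have h3 := add_mem h2 (hq i)
    simpa using h3
  · intro h
    rw [eq_sum_reesMonomial p, map_sum]
    refine sum_mem fun i _ => Ideal.subset_span (Set.mem_iUnion.2 ⟨i, ?_⟩)
    exact (initialForm_mem_loewyPiece k
      (x := ⟨_, (mem_reesAlgebra_iff (maximalIdeal A) _).1 p.2 i⟩)).2 (h i)

end Decomposition

/-! ### Powers of the maximal ideal and the socle degree -/

section Artinian

variable {A : Type*} [CommRing A] [IsLocalRing A] [IsArtinianRing A]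

theorem bddAbove_pow_maximalIdeal_ne_bot :
    BddAbove {i : ℕ | maximalIdeal A ^ i ≠ ⊥} := by
  obtain ⟨n, hn⟩ := IsArtinianRing.isNilpotent_jacobson_bot (R := A)
  rw [IsLocalRing.jacobson_eq_maximalIdeal ⊥ bot_ne_top] at hn
  refine ⟨n, fun i hi => ?_⟩
  by_contra! h
  exact hi (le_bot_iff.1 ((Ideal.pow_le_pow_right h.le).trans hn.le))

theorem pow_socleDegree_ne_bot : maximalIdeal A ^ socleDegree A ≠ ⊥ :=
  Nat.sSup_mem (s := {i : ℕ | maximalIdeal A ^ i ≠ ⊥})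
    ⟨0, by simp [Ideal.one_eq_top]⟩ bddAbove_pow_maximalIdeal_ne_bot

theorem pow_eq_bot_of_socleDegree_lt {i : ℕ} (hi : socleDegree A < i) :
    maximalIdeal A ^ i = ⊥ := by
  by_contra h
  exact absurd (le_csSup bddAbove_pow_maximalIdeal_ne_bot (show i ∈ {i | _} from h)) hi.not_ge

end Artinian

/-! ### What values 0 and 1 of the symmetric decomposition say about elements -/

section Hilbert

variable {k A : Type*} [Field k] [CommRing A] [Algebra k A] [IsLocalRing A] [Module.Finite k A]

instance (a i : ℕ) : Module.Finite k (loewyPiece k A a i) := by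
  have : Module.Finite k ↥(maximalIdeal A ^ i) :=
    Module.Finite.of_injective ((maximalIdeal A ^ i).subtype.restrictScalars k)
      Subtype.val_injective
  unfold loewyPiece
  infer_instance

theorem loewySub_le_succ_of_symHilbert_eq_zero {a i : ℕ} (h : symHilbert k A a i = 0) :
    loewySub A a i ≤ loewySub A (a + 1) i := by
  intro x hx
  unfold symHilbert at h
  rw [Module.finrank_zero_iff, Submodule.Quotient.subsingleton_iff] at h
  have hxi := loewySub_le_pow a i hx
  have h1 := (initialForm_mem_loewyPiece k (x := ⟨x, hxi⟩)).2 hx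
  have h2 : (⟨_, h1⟩ : loewyPiece k A a i) ∈
    (loewyPiece k A (a + 1) i).submoduleOf (loewyPiece k A a i) := h ▸ Submodule.mem_top
  exact (initialForm_mem_loewyPiece k).1 h2

theorem exists_generator_of_symHilbert_eq_one {a i : ℕ} (h : symHilbert k A a i = 1) :
    ∃ w ∈ maximalIdeal A ^ i, w ∈ (maximalIdeal A ^ (socleDegree A + 1 - a - i)).annihilator ∧
      w ∉ loewySub A (a + 1) i ∧
      ∀ x ∈ loewySub A a i, ∃ c : k, x - c • w ∈ loewySub A (a + 1) i := by
  obtain ⟨v, hv0, hv⟩ := finrank_eq_one_iff'.1 h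
  obtain ⟨⟨_, w, hw, rfl⟩, rfl⟩ := Submodule.mkQ_surjective _ v
  refine ⟨w, w.2, hw, fun hw' => hv0 ?_, fun x hx => ?_⟩
  · rw [Submodule.mkQ_apply, Submodule.Quotient.mk_eq_zero]
    exact (initialForm_mem_loewyPiece k).2 hw'
  · have hxi := loewySub_le_pow a i hx
    have h1 := (initialForm_mem_loewyPiece k (x := ⟨x, hxi⟩)).2 hx
    obtain ⟨c, hc⟩ := hv (Submodule.mkQ _ ⟨_, h1⟩)
    refine ⟨c, ?_⟩
    rw [eq_comm, ← map_smul, ← sub_eq_zero, ← map_sub, Submodule.mkQ_apply,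
      Submodule.Quotient.mk_eq_zero] at hc
    have hc' : initialForm k A i (⟨x, hxi⟩ - c • w) ∈ loewyPiece k A (a + 1) i := by
      rw [map_sub, map_smul]
      exact hc
    exact (initialForm_mem_loewyPiece k).1 hc'

omit [Module.Finite k A] in
theorem symHilbert_eq_zero_of_pow_eq_bot {a i : ℕ} (h : maximalIdeal A ^ i = ⊥) :
    symHilbert k A a i = 0 := by
  have : Subsingleton (loewyPiece k A a i) := by
    rw [Submodule.subsingleton_iff_eq_bot, eq_bot_iff]
    rintro _ ⟨x, -, rfl⟩
    have hx : x = 0 := Subtype.ext ((Submodule.eq_bot_iff _).1 h _ x.2)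
    simp [hx]
  exact Module.finrank_zero_of_subsingleton

theorem symHilbert_zero_socleDegree_ne_zero [IsArtinianRing A] :
    symHilbert k A 0 (socleDegree A) ≠ 0 := by
  intro h
  have hle := loewySub_le_succ_of_symHilbert_eq_zero h
  have hbot := pow_eq_bot_of_socleDegree_lt (Nat.lt_succ_self (socleDegree A))
  have hann : (maximalIdeal A ^ 0).annihilator = (⊥ : Ideal A) := by
    rw [eq_bot_iff]
    intro x hx
    simpa using Submodule.mem_annihilator.1 hx 1 (by simp)
  apply pow_socleDegree_ne_bot (A := A)
  rw [eq_bot_iff]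
  refine le_trans (le_trans ?_ hle) ?_
  · refine le_trans (le_inf le_rfl ?_) le_sup_right
    intro x hx
    rw [Submodule.mem_annihilator]
    intro n hn
    have : x * n ∈ maximalIdeal A ^ (socleDegree A + 1) := by
      rw [pow_succ]
      refine Ideal.mul_mem_mul hx ?_
      simpa using hn
    rw [hbot] at this
    exact this
  · have he : socleDegree A + 1 - (0 + 1) - socleDegree A = 0 := by omega
    rw [loewySub, he, hann, inf_bot_eq, sup_bot_eq]
    exact hbot.le

end Hilbert

/-! ### The Hilbert function of R / Ann f in and above degree j -/

section Contraction

variable {σ k : Type*} [Field k]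

theorem contractMonomial_eq_zero {f : DividedPower σ k} {j : ℕ} (hf : IsForm f j) {a : σ →₀ ℕ}
    (ha : j < a.degree) : contractMonomial a f = 0 := by
  refine Finsupp.ext fun c => ?_
  rw [contractMonomial_apply]
  by_contra h
  have := hf _ (Finsupp.mem_support_iff.2 h)
  rw [map_add] at this
  omega

theorem mem_annIdeal {f : DividedPower σ k} {h : MvPolynomial σ k} :
    h ∈ annIdeal f ↔ contract h f = 0 := Iff.rfl

theorem monomial_mem_annIdeal {f : DividedPower σ k} {j : ℕ} (hf : IsForm f j) {a : σ →₀ ℕ}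
    (ha : j < a.degree) (t : k) : MvPolynomial.monomial a t ∈ annIdeal f := by
  rw [mem_annIdeal, contract_monomial, contractMonomial_eq_zero hf ha, smul_zero]

theorem gradedHilbert_eq_zero {f : DividedPower σ k} {j i : ℕ} (hf : IsForm f j) (hi : j < i) :
    gradedHilbert (annIdeal f) i = 0 := by
  have : Submodule.map (Ideal.Quotient.mkₐ k (annIdeal f)).toLinearMap
      (MvPolynomial.homogeneousSubmodule σ k i) = ⊥ := by
    rw [eq_bot_iff]
    rintro _ ⟨p, hp, rfl⟩
    refine Ideal.Quotient.eq_zero_iff_mem.2 ?_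
    rw [p.as_sum]
    refine sum_mem fun a ha => monomial_mem_annIdeal hf ?_ _
    have : a.degree = i := by
      by_contra h
      exact MvPolynomial.mem_support_iff.1 ha
        (((MvPolynomial.mem_homogeneousSubmodule _ _).1 hp).coeff_eq_zero h)
    omega
  rw [gradedHilbert, this, finrank_bot]

theorem gradedHilbert_ne_zero [Finite σ] {f : DividedPower σ k} {j : ℕ} (hf0 : f ≠ 0)
    (hf : IsForm f j) : gradedHilbert (annIdeal f) j ≠ 0 := by
  obtain ⟨b, hb⟩ := Finsupp.ne_iff.1 hf0
  have hfin : Module.Finite k (MvPolynomial.homogeneousSubmodule σ k j) :=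
    Module.Finite.iff_fg.2 (MvPolynomial.homogeneousSubmodule_fg _ _ _)
  intro h
  rw [gradedHilbert, Module.finrank_zero_iff, Submodule.subsingleton_iff_eq_bot,
    Submodule.eq_bot_iff] at h
  have h1 := h _ ⟨MvPolynomial.monomial b 1, (MvPolynomial.mem_homogeneousSubmodule _ _).2
    (MvPolynomial.isHomogeneous_monomial _ (hf b (Finsupp.mem_support_iff.2 hb))), rfl⟩
  have h2 := Ideal.Quotient.eq_zero_iff_mem.1 h1
  rw [mem_annIdeal, contract_monomial, one_smul] at h2
  have h3 := DFunLike.congr_fun h2 0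
  rw [contractMonomial_apply, add_zero] at h3
  exact hb h3

end Contraction

/-- Both socle degrees are read off the same function: H(0) is nonzero in the socle degree of `A`
and zero above it, and H(B) behaves likewise at j. -/
theorem socleDegree_eq {σ k A : Type*} [Finite σ] [Field k] [CommRing A] [Algebra k A]
    [IsLocalRing A] [Module.Finite k A] [IsArtinianRing A] {f : DividedPower σ k} {j : ℕ}
    (hf0 : f ≠ 0) (hf : IsForm f j)
    (h : ∀ i, symHilbert k A 0 i = gradedHilbert (annIdeal f) i) : socleDegree A = j := by
  refine le_antisymm ?_ ?_
  · by_contra! hlt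
    exact symHilbert_zero_socleDegree_ne_zero ((h _).trans (gradedHilbert_eq_zero hf hlt))
  · by_contra! hlt
    exact gradedHilbert_ne_zero hf0 hf
      ((h _).symm.trans (symHilbert_eq_zero_of_pow_eq_bot (pow_eq_bot_of_socleDegree_lt hlt)))

/-- A surjective endomorphism of a Noetherian ring is injective. -/
theorem injective_of_surjective_ringEnd {S : Type*} [CommRing S] [IsNoetherianRing S]
    (f : S →+* S) (hf : Function.Surjective f) : Function.Injective f := by
  have hmono : Monotone fun n => RingHom.ker (f ^ n) := by
    refine monotone_nat_of_le_succ fun n x hx => ?_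
    rw [RingHom.mem_ker] at hx ⊢
    rw [pow_succ', RingHom.mul_def, RingHom.comp_apply, hx, map_zero]
  obtain ⟨n, hn⟩ := monotone_stabilizes_iff_noetherian.2 ‹IsNoetherianRing S› ⟨_, hmono⟩
  have hn1 : RingHom.ker (f ^ n) = RingHom.ker (f ^ (n + 1)) := hn (n + 1) n.le_succ
  rw [injective_iff_map_eq_zero]
  intro x hx
  have hsurj : Function.Surjective (f ^ n) := by
    rw [RingHom.coe_pow]; exact hf.iterate n
  obtain ⟨z, rfl⟩ := hsurj x
  rw [← RingHom.mem_ker, hn1, RingHom.mem_ker, pow_succ', RingHom.mul_def, RingHom.comp_apply, hx]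

/-! ### Forms evaluated at polynomials without constant term -/

section Polynomial

variable {σ k S : Type*} [Field k] [CommRing S] [Algebra k S]

theorem aeval_mul_of_isHomogeneous {h : MvPolynomial σ k} {e : ℕ} (hh : h.IsHomogeneous e)
    (t : S) (q : σ → S) :
    MvPolynomial.aeval (fun i => t * q i) h = t ^ e * MvPolynomial.aeval q h := by
  rw [h.as_sum, map_sum, map_sum, Finset.mul_sum]
  refine Finset.sum_congr rfl fun a ha => ?_
  have hd : a.degree = e := by
    by_contra hne
    exact MvPolynomial.mem_support_iff.1 ha (hh.coeff_eq_zero hne)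
  rw [MvPolynomial.aeval_monomial, MvPolynomial.aeval_monomial]
  simp only [mul_pow, Finsupp.prod, Finset.prod_mul_distrib, Finset.prod_pow_eq_pow_sum]
  rw [← hd, Finsupp.degree_apply]
  ring

theorem aeval_mem_pow_of_isHomogeneous {h : MvPolynomial σ k} {e : ℕ} (hh : h.IsHomogeneous e)
    {I : Ideal S} {y : σ → S} (hy : ∀ i, y i ∈ I) : MvPolynomial.aeval y h ∈ I ^ e := by
  rw [h.as_sum, map_sum]
  refine sum_mem fun a ha => ?_
  have hd : a.degree = e := by
    by_contra hne
    exact MvPolynomial.mem_support_iff.1 ha (hh.coeff_eq_zero hne)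
  rw [MvPolynomial.aeval_monomial, ← hd, Finsupp.degree_apply, ← Finset.prod_pow_eq_pow_sum]
  exact Ideal.mul_mem_left _ _ (Ideal.prod_mem_prod fun i _ => Ideal.pow_mem_pow (hy i) _)

theorem aeval_eq_X_pow_mul {P : σ → Polynomial S} (hP : ∀ i, (P i).coeff 0 = 0)
    {h : MvPolynomial σ k} {e : ℕ} (hh : h.IsHomogeneous e) :
    MvPolynomial.aeval P h =
      Polynomial.X ^ e * MvPolynomial.aeval (fun i => (P i).divX) h := by
  rw [← aeval_mul_of_isHomogeneous hh]
  congr 2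
  funext i
  conv_lhs => rw [← Polynomial.X_mul_divX_add (P i), hP i, map_zero, add_zero]

/-- Each argument is divisible by X, so X^e factors out of the value; the lowest coefficient sees
only the linear coefficients of the arguments. -/
theorem coeff_aeval_of_isHomogeneous {P : σ → Polynomial S} (hP : ∀ i, (P i).coeff 0 = 0)
    {h : MvPolynomial σ k} {e : ℕ} (hh : h.IsHomogeneous e) :
    (MvPolynomial.aeval P h).coeff e = MvPolynomial.aeval (fun i => (P i).coeff 1) h := by
  rw [aeval_eq_X_pow_mul hP hh, Polynomial.coeff_X_pow_mul', if_pos le_rfl, Nat.sub_self,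
    ← Polynomial.constantCoeff_apply, MvPolynomial.map_aeval]
  simp only [Polynomial.constantCoeff_apply, Polynomial.coeff_divX, zero_add]
  have hc : Polynomial.constantCoeff.comp (algebraMap k (Polynomial S)) = algebraMap k S := by
    ext c
    simp [Polynomial.algebraMap_apply]
  rw [hc]
  rfl

theorem coeff_one_aeval {P : σ → Polynomial S} (hP : ∀ i, (P i).coeff 0 = 0)
    (h : MvPolynomial σ k) :
    (MvPolynomial.aeval P h).coeff 1 =
      MvPolynomial.aeval (fun i => (P i).coeff 1) (MvPolynomial.homogeneousComponent 1 h) := by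
  induction h using MvPolynomial.induction_on' with
  | monomial a c =>
    have hm := MvPolynomial.isHomogeneous_monomial (d := a) c rfl
    rw [MvPolynomial.homogeneousComponent_of_mem
      ((MvPolynomial.mem_homogeneousSubmodule _ _).2 hm)]
    split_ifs with h1
    · exact coeff_aeval_of_isHomogeneous hP (h1 ▸ hm)
    · rw [aeval_eq_X_pow_mul hP hm, Polynomial.coeff_X_pow_mul', map_zero]
      split_ifs with h2
      · have h0 : a.degree = 0 := by omega
        have : a = 0 := (Finsupp.degree_eq_zero_iff a).1 h0
        subst this
        rw [MvPolynomial.aeval_monomial]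
        simp [IsScalarTower.algebraMap_apply k S (Polynomial S)]
      · rfl
  | add p q hp hq => simp [hp, hq]

end Polynomial

/-! ### Coordinates in `A` adapted to Q(0) -/

section Coordinates

variable {σ k A : Type*} [Field k] [CommRing A] [Algebra k A] [IsLocalRing A]

/-- The homomorphism from the polynomial ring to the Rees algebra with `x_i ↦ y_i t`. -/
def aevalRees {y : σ → A} (hy : ∀ i, y i ∈ maximalIdeal A) :
    MvPolynomial σ k →ₐ[k] reesAlgebra (maximalIdeal A) :=
  MvPolynomial.aeval fun i => reesMonomial 1 (y i) (by rw [pow_one]; exact hy i)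

theorem coe_aeval_rees (p : σ → reesAlgebra (maximalIdeal A)) (h : MvPolynomial σ k) :
    ((MvPolynomial.aeval p h : reesAlgebra (maximalIdeal A)) : Polynomial A) =
      MvPolynomial.aeval (fun i => (p i : Polynomial A)) h := by
  have := DFunLike.congr_fun (MvPolynomial.comp_aeval p
    ((reesAlgebra (maximalIdeal A)).val.restrictScalars k)) h
  exact this

theorem coeff_aevalRees {y : σ → A} (hy : ∀ i, y i ∈ maximalIdeal A) {h : MvPolynomial σ k}
    {e : ℕ} (hh : h.IsHomogeneous e) (l : ℕ) :
    (aevalRees hy h : Polynomial A).coeff l = if e = l then MvPolynomial.aeval y h else 0 := by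
  have hp : (aevalRees hy h : Polynomial A) =
      Polynomial.X ^ e * Polynomial.C (MvPolynomial.aeval y h) := by
    rw [aevalRees, coe_aeval_rees]
    have h1 : (fun i => ((reesMonomial 1 (y i) (by rw [pow_one]; exact hy i) :
        reesAlgebra (maximalIdeal A)) : Polynomial A)) =
        fun i => Polynomial.X * Polynomial.C (y i) := by
      funext i
      change Polynomial.monomial 1 (y i) = _
      rw [← Polynomial.C_mul_X_eq_monomial, mul_comm]
    rw [h1, aeval_mul_of_isHomogeneous hh]
    congr 1
    exact (MvPolynomial.comp_aeval_apply y (Polynomial.CAlgHom (R := k) (A := A)) h).symm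
  rw [hp, Polynomial.coeff_X_pow_mul', Polynomial.coeff_C]
  split_ifs <;> first | rfl | omega

theorem reesToQZero_aevalRees_eq_zero {y : σ → A} (hy : ∀ i, y i ∈ maximalIdeal A)
    {h : MvPolynomial σ k} {e : ℕ} (hh : h.IsHomogeneous e) :
    reesToQZero k (aevalRees hy h) = 0 ↔ MvPolynomial.aeval y h ∈ loewySub A 1 e := by
  rw [reesToQZero_eq_zero]
  constructor
  · intro H
    simpa [coeff_aevalRees hy hh] using H e
  · intro H l
    rw [coeff_aevalRees hy hh]
    split_ifs with hl
    · exact hl ▸ H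
    · exact zero_mem _

/-- In degree 0 the exponent is the socle degree j; a unit annihilating 𝔪^j would force 𝔪^j = 0. -/
theorem loewySub_one_zero_le [IsArtinianRing A] : loewySub A 1 0 ≤ maximalIdeal A := by
  refine sup_le (by simp) (inf_le_right.trans (IsLocalRing.le_maximalIdeal fun h => ?_))
  have h1 := Submodule.mem_annihilator.1 (h ▸ Submodule.mem_top (x := (1 : A)))
  refine pow_socleDegree_ne_bot (A := A) ((Submodule.eq_bot_iff _).2 fun x hx => ?_)
  simpa using h1 x (by simpa using hx)

theorem reesToQZero_reesMonomial_eq_zero {i : ℕ} {x : A} (hx : x ∈ maximalIdeal A ^ i)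
    (h : x ∈ loewySub A 1 i) : reesToQZero k (reesMonomial i x hx) = 0 := by
  rw [reesToQZero_eq_zero]
  intro l
  rw [coeff_reesMonomial]
  split_ifs with hl
  · exact hl ▸ h
  · exact zero_mem _

/-- Q(0) is generated in degree 1, so representing its linear part by linear forms in y represents
each degree by forms. -/
theorem exists_aeval_sub_mem_loewySub
    (hres : ∀ a : A, ∃ c : k, a - algebraMap k A c ∈ maximalIdeal A)
    {y : σ → A} (hy : ∀ i, y i ∈ maximalIdeal A)
    (hlin : ∀ a ∈ maximalIdeal A, ∃ h : MvPolynomial σ k, h.IsHomogeneous 1 ∧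
      a - MvPolynomial.aeval y h ∈ loewySub A 1 1) (i : ℕ) :
    ∀ a ∈ maximalIdeal A ^ i, ∃ h : MvPolynomial σ k, h.IsHomogeneous i ∧
      a - MvPolynomial.aeval y h ∈ loewySub A 1 i := by
  induction i with
  | zero =>
    intro a _
    obtain ⟨c, hc⟩ := hres a
    refine ⟨MvPolynomial.C c, MvPolynomial.isHomogeneous_C _ _, pow_succ_le_loewySub 1 0 ?_⟩
    simpa using hc
  | succ i ih =>
    intro a ha
    rw [pow_succ'] at ha
    refine Submodule.mul_induction_on ha (fun b hb c hc => ?_) ?_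
    · obtain ⟨g, hg, hg'⟩ := hlin b hb
      obtain ⟨h, hh, hh'⟩ := ih c hc
      refine ⟨g * h, add_comm 1 i ▸ hg.mul hh, ?_⟩
      have h1 := mul_mem_loewySub 1 1 i b _ (by rwa [pow_one]) hh'
      have h2 := mul_mem_loewySub 1 i 1 (MvPolynomial.aeval y h) _
        (aeval_mem_pow_of_isHomogeneous hh hy) hg'
      rw [add_comm] at h1
      convert add_mem h1 h2 using 1
      rw [map_mul]
      ring
    · rintro b c ⟨g, hg, hg'⟩ ⟨h, hh, hh'⟩
      refine ⟨g + h, hg.add hh, ?_⟩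
      convert add_mem hg' hh' using 1
      rw [map_add]
      ring

/-- The isomorphism θ need not respect gradings. Lift the images of the variables to the Rees
algebra and keep only the coefficient of t as y_i: lowest coefficients show that the graded map x_i
↦ y_i t still kills I and is still onto Q(0). Composed with θ it is a surjective endomorphism of a
Noetherian ring, so nothing outside I is killed. -/
theorem exists_coordinates [Finite σ] [IsArtinianRing A]
    (hres : ∀ a : A, ∃ c : k, a - algebraMap k A c ∈ maximalIdeal A)
    {I : Ideal (MvPolynomial σ k)} {G : Set (MvPolynomial σ k)}
    (hG : ∀ g ∈ G, ∃ e, g.IsHomogeneous e) (hspan : Ideal.span G = I)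
    (hnil : ∀ i, ∃ n, MvPolynomial.X i ^ n ∈ I) (θ : QZero k A ≃ₐ[k] (MvPolynomial σ k ⧸ I)) :
    ∃ y : σ → A, (∀ i, y i ∈ maximalIdeal A) ∧
      (∀ a ∈ maximalIdeal A, ∃ h : MvPolynomial σ k, h.IsHomogeneous 1 ∧
        a - MvPolynomial.aeval y h ∈ loewySub A 1 1) ∧
      ∀ (e : ℕ) (h : MvPolynomial σ k), h.IsHomogeneous e →
        (MvPolynomial.aeval y h ∈ loewySub A 1 e ↔ h ∈ I) := by
  have hlift : ∀ i, ∃ p : reesAlgebra (maximalIdeal A), (p : Polynomial A).coeff 0 = 0 ∧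
      reesToQZero k p = θ.symm (Ideal.Quotient.mk I (MvPolynomial.X i)) := by
    intro i
    obtain ⟨p, hp⟩ := reesToQZero_surjective k (θ.symm (Ideal.Quotient.mk I (MvPolynomial.X i)))
    -- Variables are nilpotent modulo I, so the constant coefficient has a power in 𝔪. It can then
    -- be dropped, as elements of 𝔪 vanish in degree 0 of Q(0).
    have h0 : (p : Polynomial A).coeff 0 ∈ maximalIdeal A := by
      obtain ⟨n, hn⟩ := hnil i
      have h1 : reesToQZero k (p ^ n) = 0 := by
        rw [map_pow, hp, ← map_pow, ← map_pow, Ideal.Quotient.eq_zero_iff_mem.2 hn, map_zero]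
      have h2 := loewySub_one_zero_le ((reesToQZero_eq_zero k).1 h1 0)
      rw [SubmonoidClass.coe_pow, ← Polynomial.constantCoeff_apply, map_pow] at h2
      exact (maximalIdeal.isMaximal A).isPrime.mem_of_pow_mem n h2
    refine ⟨p - reesMonomial 0 ((p : Polynomial A).coeff 0) (by simp), ?_, ?_⟩
    · rw [AddSubgroupClass.coe_sub, Polynomial.coeff_sub, coeff_reesMonomial, if_pos rfl, sub_self]
    · rw [map_sub, hp, reesToQZero_reesMonomial_eq_zero _ (pow_succ_le_loewySub 1 0 (by simpa)),
        sub_zero]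
  choose p hp0 hp using hlift
  set y : σ → A := fun i => (p i : Polynomial A).coeff 1 with hydef
  have hy : ∀ i, y i ∈ maximalIdeal A := fun i => by
    simpa using (mem_reesAlgebra_iff (maximalIdeal A) _).1 (p i).2 1
  have hθ : ∀ h, reesToQZero k (MvPolynomial.aeval p h) = θ.symm (Ideal.Quotient.mk I h) := by
    intro h
    have : (reesToQZero k).comp (MvPolynomial.aeval p) =
        (θ.symm : _ →ₐ[k] QZero k A).comp (Ideal.Quotient.mkₐ k I) :=
      MvPolynomial.algHom_ext fun i => by simpa using hp i
    exact DFunLike.congr_fun this h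
  have hlin : ∀ a ∈ maximalIdeal A, ∃ h : MvPolynomial σ k, h.IsHomogeneous 1 ∧
      a - MvPolynomial.aeval y h ∈ loewySub A 1 1 := by
    intro a ha
    have ha1 : a ∈ maximalIdeal A ^ 1 := by rwa [pow_one]
    obtain ⟨h, hh⟩ := Ideal.Quotient.mk_surjective (θ (reesToQZero k (reesMonomial 1 a ha1)))
    refine ⟨MvPolynomial.homogeneousComponent 1 h,
      MvPolynomial.homogeneousComponent_isHomogeneous 1 h, ?_⟩
    have h0 : reesToQZero k (reesMonomial 1 a ha1 - MvPolynomial.aeval p h) = 0 := by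
      rw [map_sub, hθ, hh, AlgEquiv.symm_apply_apply, sub_self]
    have h1 := (reesToQZero_eq_zero k).1 h0 1
    rwa [AddSubgroupClass.coe_sub, Polynomial.coeff_sub, coeff_reesMonomial, if_pos rfl,
      coe_aeval_rees, coeff_one_aeval hp0] at h1
  set Θ : MvPolynomial σ k →ₐ[k] QZero k A := (reesToQZero k).comp (aevalRees hy) with hΘ
  have hΘzero : ∀ {e : ℕ} {h : MvPolynomial σ k}, h.IsHomogeneous e →
      (Θ h = 0 ↔ MvPolynomial.aeval y h ∈ loewySub A 1 e) := fun hh =>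
    reesToQZero_aevalRees_eq_zero hy hh
  have hker : ∀ h ∈ I, Θ h = 0 := by
    have hle : I ≤ RingHom.ker Θ := by
      rw [← hspan, Ideal.span_le]
      intro g hg
      obtain ⟨e, he⟩ := hG g hg
      refine (hΘzero he).2 ?_
      have h0 : reesToQZero k (MvPolynomial.aeval p g) = 0 := by
        rw [hθ, Ideal.Quotient.eq_zero_iff_mem.2 (hspan ▸ Ideal.subset_span hg), map_zero]
      have h1 := (reesToQZero_eq_zero k).1 h0 e
      rwa [coe_aeval_rees, coeff_aeval_of_isHomogeneous hp0 he] at h1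
    exact hle
  have hsurj : Function.Surjective Θ := by
    rw [← AlgHom.range_eq_top, eq_top_iff]
    rintro q -
    obtain ⟨q, rfl⟩ := reesToQZero_surjective k q
    rw [eq_sum_reesMonomial q, map_sum]
    refine sum_mem fun i _ => ?_
    obtain ⟨h, hh, hh'⟩ := exists_aeval_sub_mem_loewySub hres hy hlin i _
      ((mem_reesAlgebra_iff (maximalIdeal A) _).1 q.2 i)
    refine ⟨h, ?_⟩
    change reesToQZero k (aevalRees hy h) = _
    rw [eq_comm, ← sub_eq_zero, ← map_sub, reesToQZero_eq_zero]
    intro l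
    rw [AddSubgroupClass.coe_sub, Polynomial.coeff_sub, coeff_reesMonomial, coeff_aevalRees hy hh]
    split_ifs with hl
    · exact hl ▸ hh'
    · simp
  have hinj : ∀ h, Θ h = 0 → h ∈ I := by
    intro h hh
    let Ψ : (MvPolynomial σ k ⧸ I) →+* (MvPolynomial σ k ⧸ I) :=
      (θ : QZero k A →+* _).comp (Ideal.Quotient.lift I (Θ : _ →+* QZero k A) hker)
    have hΨ : Function.Surjective Ψ :=
      θ.surjective.comp (Ideal.Quotient.lift_surjective_of_surjective _ _ hsurj)
    have h1 := injective_of_surjective_ringEnd Ψ hΨ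
    refine Ideal.Quotient.eq_zero_iff_mem.1 (h1 ?_)
    rw [map_zero]
    change θ (Θ h) = 0
    rw [hh, map_zero]
  exact ⟨y, hy, hlin, fun e h hh => (hΘzero hh).symm.trans ⟨hinj h, hker h⟩⟩

end Coordinates

/-! ### The residue field and a functional detecting the socle -/

section Socle

variable {k A : Type*} [Field k] [CommRing A] [Algebra k A] [IsLocalRing A]

theorem IsArtinianGorenstein.exists_sub_algebraMap_mem (hA : IsArtinianGorenstein k A) (a : A) :
    ∃ c : k, a - algebraMap k A c ∈ maximalIdeal A := by
  obtain ⟨c, hc⟩ := hA.residue.2 (IsLocalRing.residue A a)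
  refine ⟨c, ?_⟩
  rw [← residue_eq_zero_iff, map_sub, ← hc, sub_eq_zero]
  rfl

theorem IsArtinianGorenstein.exists_functional (hA : IsArtinianGorenstein k A) :
    ∃ φ : A →ₗ[k] k, ∀ x ∈ (maximalIdeal A).annihilator, φ x = 0 → x = 0 := by
  let p : Submodule k A := (maximalIdeal A).annihilator.restrictScalars k
  have hp : Module.finrank k p = 1 := hA.socle
  have : Module.Finite k p := Module.finite_of_finrank_eq_succ hp
  let ε : p ≃ₗ[k] k := LinearEquiv.ofFinrankEq _ _ (by rw [hp, Module.finrank_self])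
  obtain ⟨φ, hφ⟩ := LinearMap.exists_extend (ε : p →ₗ[k] k)
  refine ⟨φ, fun x hx h0 => ?_⟩
  have h1 : ε ⟨x, hx⟩ = 0 := by
    rw [← h0]; exact (DFunLike.congr_fun hφ ⟨x, hx⟩).symm
  simpa using congrArg Subtype.val ((map_eq_zero_iff ε ε.injective).1 h1)

end Socle

/-! ### Using the bound on the degrees of generators -/

section Generation

variable {σ k A : Type*} [Field k] [CommRing A] [Algebra k A]

/-- If `I` is generated in degrees at most `d` and `w` kills `y_i h(y)` for all `i` and all forms
`h` of degree `d` in `I`, then `w` kills `h(y)` for all forms `h` of degree `d + 1` in `I`. -/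
theorem mul_aeval_eq_zero_of_generated {I : Ideal (MvPolynomial σ k)} {d : ℕ}
    (hI : GeneratedInDegreeLE I d) {y : σ → A} {w : A}
    (hw : ∀ h ∈ I, h.IsHomogeneous d → ∀ i, w * (y i * MvPolynomial.aeval y h) = 0)
    {h : MvPolynomial σ k} (hh : h.IsHomogeneous (d + 1)) (hhI : h ∈ I) :
    w * MvPolynomial.aeval y h = 0 := by
  obtain ⟨G, hG, rfl⟩ := hI
  -- The multiplier c lets the span induction pass through products; taking the component of degree
  -- d + 1 is needed because intermediate sums are not homogeneous.
  have key : ∀ c : MvPolynomial σ k,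
      w * MvPolynomial.aeval y (MvPolynomial.homogeneousComponent (d + 1) (c * h)) = 0 := by
    clear hh
    induction hhI using Submodule.span_induction with
    | mem g hg =>
      obtain ⟨e, he, hge⟩ := hG g hg
      intro c
      induction c using MvPolynomial.induction_on' with
      | monomial a t =>
        have hm := (MvPolynomial.isHomogeneous_monomial (d := a) t rfl).mul hge
        rw [MvPolynomial.homogeneousComponent_of_mem
          ((MvPolynomial.mem_homogeneousSubmodule _ _).2 hm)]
        split_ifs with hd
        · have ha : a ≠ 0 := by
            rintro rfl
            rw [map_zero] at hd
            omega
          obtain ⟨i, hi⟩ := Finsupp.ne_iff.1 ha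
          have hle : Finsupp.single i 1 ≤ a :=
            Finsupp.single_le_iff.2 (Nat.one_le_iff_ne_zero.2 hi)
          obtain ⟨b, rfl⟩ := exists_add_of_le hle
          have hb : MvPolynomial.monomial (Finsupp.single i 1 + b) t =
              MvPolynomial.X i * MvPolynomial.monomial b t := by
            rw [MvPolynomial.X, MvPolynomial.monomial_mul, one_mul]
          rw [hb, mul_assoc, map_mul, MvPolynomial.aeval_X]
          refine hw _ (Ideal.mul_mem_left _ _ (Ideal.subset_span hg)) ?_ i
          have hdeg : b.degree + e = d := by
            rw [map_add, Finsupp.degree_single] at hd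
            omega
          exact hdeg ▸ (MvPolynomial.isHomogeneous_monomial (d := b) t rfl).mul hge
        · rw [map_zero, mul_zero]
      | add p q hp hq => rw [add_mul, map_add, map_add, mul_add, hp, hq, add_zero]
    | zero => simp
    | add x z _ _ hx hz =>
      intro c
      rw [mul_add, map_add, map_add, mul_add, hx, hz, add_zero]
    | smul a x _ hx =>
      intro c
      rw [smul_eq_mul, ← mul_assoc]
      exact hx _
  have h1 := key 1
  rwa [one_mul, MvPolynomial.homogeneousComponent_of_mem
    ((MvPolynomial.mem_homogeneousSubmodule _ _).2 hh), if_pos rfl] at h1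

end Generation

/-! ### The generator of Q(1) in degree 1 vanishes (n = j - 5) -/

section Contradiction

variable {σ k A : Type*} [Finite σ] [Field k] [CommRing A] [Algebra k A] [IsLocalRing A]

theorem mem_loewySub_iff {a i d : ℕ} (hd : socleDegree A + 1 - a - i = d) {x : A} :
    x ∈ loewySub A a i ↔ ∃ s ∈ maximalIdeal A ^ (i + 1), ∃ t ∈ maximalIdeal A ^ i,
      (∀ z ∈ maximalIdeal A ^ d, t * z = 0) ∧ s + t = x := by
  rw [mem_loewySub, hd]
  simp only [Submodule.mem_annihilator, smul_eq_mul]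

omit [IsLocalRing A] in
theorem mul_mem_pow_of_le {I : Ideal A} {a b c : ℕ} {x z : A} (hx : x ∈ I ^ a) (hz : z ∈ I ^ b)
    (hc : c ≤ a + b) : x * z ∈ I ^ c :=
  Ideal.pow_le_pow_right hc (pow_add I a b ▸ Ideal.mul_mem_mul hx hz)

/-- If `w` kills `h(y)` for all forms `h` of degree `j - 2` in `I`, then multiplication by `w` on
the forms of degree `j - 2` in `y` agrees with multiplication by some element of `𝔪 ^ 2`. -/
theorem exists_quadric_of_annihilates (hA : IsArtinianGorenstein k A) {n : ℕ}
    (hJ : socleDegree A = n + 5) {I : Ideal (MvPolynomial σ k)} {y : σ → A}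
    (hy : ∀ i, y i ∈ maximalIdeal A)
    (hlin : ∀ a ∈ maximalIdeal A, ∃ h : MvPolynomial σ k, h.IsHomogeneous 1 ∧
      a - MvPolynomial.aeval y h ∈ loewySub A 1 1)
    (hI : ∀ (e : ℕ) (h : MvPolynomial σ k), h.IsHomogeneous e →
      (MvPolynomial.aeval y h ∈ loewySub A 1 e ↔ h ∈ I))
    {w : A} (hw : ∀ z ∈ maximalIdeal A ^ (n + 4), w * z = 0)
    (hwI : ∀ h ∈ I, h.IsHomogeneous (n + 3) → w * MvPolynomial.aeval y h = 0) :
    ∃ q ∈ maximalIdeal A ^ 2, ∀ h : MvPolynomial σ k, h.IsHomogeneous (n + 3) →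
      (w - q) * MvPolynomial.aeval y h = 0 := by
  have := hA.artinian
  obtain ⟨φ, hφ⟩ := hA.exists_functional
  have hbot : ∀ x ∈ maximalIdeal A ^ (n + 6), x = 0 :=
    (Submodule.eq_bot_iff _).1 (pow_eq_bot_of_socleDegree_lt (by omega))
  have hy' : ∀ {e : ℕ} {h : MvPolynomial σ k}, h.IsHomogeneous e →
      MvPolynomial.aeval y h ∈ maximalIdeal A ^ e := fun hh => aeval_mem_pow_of_isHomogeneous hh hy
  have hsoc : ∀ x, (∀ z ∈ maximalIdeal A, x * z = 0) → φ x = 0 → x = 0 := fun x hx =>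
    hφ x (Submodule.mem_annihilator.2 hx)
  have hfin : Module.Finite k (MvPolynomial.homogeneousSubmodule σ k (n + 3)) :=
    Module.Finite.iff_fg.2 (MvPolynomial.homogeneousSubmodule_fg _ _ _)
  -- Duality between degrees 2 and j - 2: modulo 𝔪³ and elements killing 𝔪^(j-2), 𝔪² consists of
  -- quadrics in y. A form orthogonal to all quadrics therefore kills 𝔪², hence vanishes in Q(0).
  have hmem : ∀ h : MvPolynomial σ k, h.IsHomogeneous (n + 3) →
      (∀ q : MvPolynomial σ k, q.IsHomogeneous 2 →
        φ (MvPolynomial.aeval y q * MvPolynomial.aeval y h) = 0) → h ∈ I := by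
    intro h hh hq
    refine (hI _ h hh).1 ((mem_loewySub_iff (d := 2) (by omega)).2
      ⟨0, zero_mem _, _, hy' hh, fun z hz => ?_, zero_add _⟩)
    obtain ⟨q, hq2, hzq⟩ := exists_aeval_sub_mem_loewySub hA.exists_sub_algebraMap_mem hy hlin 2 z hz
    obtain ⟨s, hs, t, -, ht, hst⟩ := (mem_loewySub_iff (d := n + 3) (by omega)).1 hzq
    have h1 : MvPolynomial.aeval y q * MvPolynomial.aeval y h = 0 :=
      hsoc _ (fun z hz => hbot _ (mul_mem_pow_of_le (b := 1)
        (mul_mem_pow_of_le (hy' hq2) (hy' hh) le_rfl) (by rwa [pow_one]) (by omega))) (hq q hq2)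
    have h2 := ht _ (hy' hh)
    have h3 := hbot _ (mul_mem_pow_of_le hs (hy' hh) (by omega))
    linear_combination h1 + h2 + h3 - (MvPolynomial.aeval y h) * hst
  let ι : MvPolynomial.homogeneousSubmodule σ k (n + 3) →ₗ[k] A :=
    (MvPolynomial.aeval y).toLinearMap.comp (Submodule.subtype _)
  let T : A →ₗ[k] Module.Dual k (MvPolynomial.homogeneousSubmodule σ k (n + 3)) :=
    ((LinearMap.mul k A).compr₂ φ).compl₂ ι
  have hT : ∀ a h, T a h = φ (a * MvPolynomial.aeval y (h : MvPolynomial σ k)) := fun _ _ => rfl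
  let W : Submodule k (Module.Dual k (MvPolynomial.homogeneousSubmodule σ k (n + 3))) :=
    (MvPolynomial.homogeneousSubmodule σ k 2).map (T.comp (MvPolynomial.aeval y).toLinearMap)
  have hwW : T w ∈ W := by
    -- Finite-dimensional double annihilator: a functional vanishing on the common kernel of the
    -- quadric functionals is one of them.
    rw [← Subspace.dualCoannihilator_dualAnnihilator_eq (W := W), Submodule.mem_dualAnnihilator]
    intro h hh
    rw [Submodule.mem_dualCoannihilator] at hh
    rw [hT, hwI _ (hmem h h.2 fun q hq => hh _ ⟨q, hq, rfl⟩) h.2, map_zero]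
  obtain ⟨q, hq, hqw⟩ := hwW
  refine ⟨MvPolynomial.aeval y q, hy' hq, fun h hh => hsoc _ (fun z hz => ?_) ?_⟩
  · have hz1 : z ∈ maximalIdeal A ^ 1 := by rwa [pow_one]
    have h1 := hw _ (mul_mem_pow_of_le (hy' hh) hz1 (by omega))
    have h2 := hbot _ (mul_mem_pow_of_le (hy' hq) (mul_mem_pow_of_le (hy' hh) hz1 le_rfl)
      (by omega))
    linear_combination h1 - h2
  · have h1 : φ (MvPolynomial.aeval y q * MvPolynomial.aeval y h) =
        φ (w * MvPolynomial.aeval y h) := DFunLike.congr_fun hqw ⟨h, hh⟩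
    rw [sub_mul, map_sub, h1, sub_self]

/-- If `I` is generated in degrees at most `j - 3` and `Q(1)` vanishes in the degrees `2` and
`j - 3`, then an element `w` that spans `Q(1)` in degree `1` is zero in `Q(1)`. -/
theorem mem_loewySub_of_generated (hA : IsArtinianGorenstein k A) {n : ℕ}
    (hJ : socleDegree A = n + 5) {I : Ideal (MvPolynomial σ k)}
    (hgen : GeneratedInDegreeLE I (n + 2)) {y : σ → A}
    (hy : ∀ i, y i ∈ maximalIdeal A)
    (hlin : ∀ a ∈ maximalIdeal A, ∃ h : MvPolynomial σ k, h.IsHomogeneous 1 ∧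
      a - MvPolynomial.aeval y h ∈ loewySub A 1 1)
    (hI : ∀ (e : ℕ) (h : MvPolynomial σ k), h.IsHomogeneous e →
      (MvPolynomial.aeval y h ∈ loewySub A 1 e ↔ h ∈ I))
    (h2 : loewySub A 1 2 ≤ loewySub A 2 2)
    (h3 : loewySub A 1 (n + 2) ≤ loewySub A 2 (n + 2))
    {w : A} (hwm : w ∈ maximalIdeal A) (hw : ∀ z ∈ maximalIdeal A ^ (n + 4), w * z = 0)
    (hspan : ∀ x ∈ loewySub A 1 1, ∃ c : k, x - c • w ∈ loewySub A 2 1) :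
    w ∈ loewySub A 2 1 := by
  have := hA.artinian
  have hbot : ∀ x ∈ maximalIdeal A ^ (n + 6), x = 0 :=
    (Submodule.eq_bot_iff _).1 (pow_eq_bot_of_socleDegree_lt (by omega))
  have hy' : ∀ {e : ℕ} {h : MvPolynomial σ k}, h.IsHomogeneous e →
      MvPolynomial.aeval y h ∈ maximalIdeal A ^ e := fun hh => aeval_mem_pow_of_isHomogeneous hh hy
  have hw1 : w ∈ maximalIdeal A ^ 1 := by rwa [pow_one]
  have hwI : ∀ h ∈ I, h.IsHomogeneous (n + 3) → w * MvPolynomial.aeval y h = 0 := by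
    intro h hhI hh
    refine mul_aeval_eq_zero_of_generated hgen (fun g hgI hg i => ?_) hh hhI
    -- As Q(1) is zero in degree j - 3, g(y) splits into s ∈ 𝔪^(j-2) and t killing 𝔪². Here y_i s ∈
    -- 𝔪^(j-1) is killed by w, and w y_i ∈ 𝔪² by t.
    obtain ⟨s, hs, t, -, ht, hst⟩ := (mem_loewySub_iff (d := 2) (by omega)).1
      (h3 ((hI _ g hg).2 hgI))
    have hyi : y i ∈ maximalIdeal A ^ 1 := by rw [pow_one]; exact hy i
    have e1 := hw _ (mul_mem_pow_of_le hyi hs (by omega))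
    have e2 := ht _ (mul_mem_pow_of_le hw1 hyi le_rfl)
    linear_combination e1 + e2 - w * y i * hst
  obtain ⟨q, hq, hqw⟩ := exists_quadric_of_annihilates hA hJ hy hlin hI hw hwI
  -- For x ∈ 𝔪, the product wx lies in C(1) in degree 2, where Q(1) is zero; so wx splits into an
  -- element of 𝔪³ and one killing 𝔪^(j-3).
  have hww : ∀ z ∈ maximalIdeal A ^ (n + 2), w * w * z = 0 := by
    intro z hz
    rw [pow_succ'] at hz
    refine Submodule.mul_induction_on hz (fun x hx u hu => ?_) fun a b ha hb => ?_
    · have hx1 : x ∈ maximalIdeal A ^ 1 := by rwa [pow_one]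
      obtain ⟨s, hs, t, -, ht, hst⟩ := (mem_loewySub_iff (d := n + 2) (by omega)).1
        (h2 ((mem_loewySub_iff (d := n + 3) (by omega)).2
          ⟨0, zero_mem _, w * x, mul_mem_pow_of_le hw1 hx1 le_rfl, fun z hz => by
            rw [mul_assoc]; exact hw _ (mul_mem_pow_of_le hx1 hz (by omega)), zero_add _⟩))
      have e1 := hw _ (mul_mem_pow_of_le hs hu (by omega))
      have e2 := ht _ (mul_mem_pow_of_le hw1 hu (by omega))
      linear_combination e1 + e2 - w * u * hst
    · rw [mul_add, ha, hb, add_zero]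
  have hkill : ∀ z ∈ maximalIdeal A ^ (n + 4), (w - q) * z = 0 := by
    intro z hz
    rw [sub_mul, hw z hz, hbot _ (mul_mem_pow_of_le hq hz (by omega)), sub_zero]
  -- Factors from 𝔪 are traded one by one for linear forms in y; once all are traded, the choice of
  -- q applies.
  have key : ∀ l i, i + l = n + 3 → ∀ h : MvPolynomial σ k, h.IsHomogeneous i →
      ∀ u ∈ maximalIdeal A ^ l, (w - q) * (MvPolynomial.aeval y h * u) = 0 := by
    intro l
    induction l with
    | zero =>
      intro i hi h hh u _
      obtain rfl : i = n + 3 := hi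
      obtain ⟨c, hc⟩ := hA.exists_sub_algebraMap_mem u
      have e1 := hkill _ (mul_mem_pow_of_le (b := 1) (hy' hh) (by rwa [pow_one]) (by omega))
      linear_combination e1 + algebraMap k A c * hqw h hh
    | succ l ih =>
      intro i hi h hh u hu
      rw [pow_succ'] at hu
      refine Submodule.mul_induction_on hu (fun x hx v hv => ?_) fun a b ha hb => ?_
      · obtain ⟨g, hg, hxg⟩ := hlin x hx
        obtain ⟨c, hc⟩ := hspan _ hxg
        -- Now x = g(y) + c w + s + t, with s ∈ 𝔪² and t killing 𝔪^(j-2). Only the term g(y) needs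
        -- induction; the c w term dies by `hww` and w𝔪^(j-1) = 0.
        obtain ⟨s, hs, t, -, ht, hst⟩ := (mem_loewySub_iff (d := n + 3) (by omega)).1 hc
        have e1 := ih (i + 1) (by omega) _ (hh.mul hg) v hv
        rw [map_mul] at e1
        have hhv := mul_mem_pow_of_le (c := n + 2) (hy' hh) hv (by omega)
        have e2 := hww _ hhv
        have e3 := hw _ (mul_mem_pow_of_le hq hhv (by omega))
        have e4 := hkill _ (mul_mem_pow_of_le hs hhv (by omega))
        have e5 := ht _ (mul_mem_pow_of_le hw1 hhv (by omega))
        have e6 := ht _ (mul_mem_pow_of_le (c := n + 3) hq hhv (by omega))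
        rw [Algebra.smul_def] at hst
        linear_combination e1 + algebraMap k A c * (e2 - e3) + e4 + e5 - e6 -
          (w - q) * MvPolynomial.aeval y h * v * hst
      · rw [mul_add, mul_add, ha, hb, add_zero]
  refine (mem_loewySub_iff (d := n + 3) (by omega)).2 ⟨q, hq, w - q, ?_, fun z hz => ?_, by ring⟩
  · rw [pow_one]
    exact sub_mem hwm (by simpa using Ideal.pow_le_pow_right one_le_two hq)
  · simpa using key (n + 3) 0 (by omega) 1 (MvPolynomial.isHomogeneous_one _ _) z hz

end Contradiction

/-- The bound j ≥ 5 keeps degrees 2 and j - 3 away from the two ones of H(1), in degrees 1 and j -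
2. -/
theorem not_decompositionStartsWith {σ k A : Type*} [Finite σ] [Field k] [CommRing A] [Algebra k A]
    [IsLocalRing A] [Module.Finite k A] {j : ℕ} (hj : 5 ≤ j) {f : DividedPower σ k} (hf0 : f ≠ 0)
    (hf : IsForm f j) (hgen : GeneratedInDegreeLE (annIdeal f) (j - 3))
    (hA : IsArtinianGorenstein k A) (θ : QZero k A ≃ₐ[k] (MvPolynomial σ k ⧸ annIdeal f)) :
    ¬ DecompositionStartsWith k A 1 (pairDecomp (gradedHilbert (annIdeal f)) (hOne j)) := by
  intro hD
  have := hA.artinian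
  have hJ : socleDegree A = j := socleDegree_eq hf0 hf (hD 0 zero_le_one)
  have hD1 : ∀ i, symHilbert k A 1 i = hOne j i := hD 1 le_rfl
  obtain ⟨n, rfl⟩ := Nat.exists_eq_add_of_le' hj
  obtain ⟨G, hG, hspan⟩ := id hgen
  have hnil : ∀ i, ∃ m, MvPolynomial.X i ^ m ∈ annIdeal f := fun i =>
    ⟨n + 6, by
      rw [MvPolynomial.X_pow_eq_monomial]
      exact monomial_mem_annIdeal hf (by rw [Finsupp.degree_single]; omega) 1⟩
  obtain ⟨y, hy, hlin, hI⟩ := exists_coordinates hA.exists_sub_algebraMap_mem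
    (fun g hg => (hG g hg).imp fun e he => he.2) hspan hnil θ
  obtain ⟨w, hwm, hw, hw2, hwspan⟩ := exists_generator_of_symHilbert_eq_one
    (k := k) (A := A) (a := 1) (i := 1) ((hD1 1).trans (by simp [hOne]))
  refine hw2 (mem_loewySub_of_generated hA hJ hgen hy hlin hI
    (loewySub_le_succ_of_symHilbert_eq_zero ((hD1 2).trans ?_))
    (loewySub_le_succ_of_symHilbert_eq_zero ((hD1 (n + 2)).trans ?_))
    (by simpa using hwm) (fun z hz => ?_) hwspan)
  · rw [hOne, if_neg (by omega)]
  · rw [hOne, if_neg (by omega)]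
  · refine Submodule.mem_annihilator.1 hw z ?_
    rwa [hJ]

end SymDecomp
end

open SymDecomp in
theorem mainTheorem4 {k : Type*} [Field k] (r j : ℕ) (hj : 5 ≤ j)
    (f : DividedPower (Fin r) k) (hf0 : f ≠ 0) (hf : IsForm f j)
    (hgen : GeneratedInDegreeLE (annIdeal f) (j - 3))
    {A : Type*} [CommRing A] [Algebra k A] [IsLocalRing A] (hA : IsArtinianGorenstein k A)
    (hQ : Nonempty (QZero k A ≃ₐ[k] (MvPolynomial (Fin r) k ⧸ annIdeal f))) :
    ((∃ φ : MvPolynomial (Fin (r + 1)) k →ₐ[k] A, Function.Surjective φ) →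
      ¬ IsCompleteDecomposition k A (pairDecomp (gradedHilbert (annIdeal f)) (hOne j))) ∧
    ((∃ (n : ℕ) (φ : MvPolynomial (Fin n) k →ₐ[k] A), Function.Surjective φ) →
      ¬ DecompositionStartsWith k A 1 (pairDecomp (gradedHilbert (annIdeal f)) (hOne j))) := by
  obtain ⟨θ⟩ := hQ
  have := hA.artinian
  have hfin : ∀ {n : ℕ} (φ : MvPolynomial (Fin n) k →ₐ[k] A), Function.Surjective φ →
      Module.Finite k A := fun φ hφ =>
    have : Algebra.FiniteType k A := Algebra.FiniteType.of_surjective φ hφ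
    Module.finite_of_isArtinianRing k A
  refine ⟨?_, ?_⟩
  · rintro ⟨φ, hφ⟩ hD
    have := hfin φ hφ
    have hJ : socleDegree A = j := socleDegree_eq hf0 hf (hD 0 (Nat.zero_le _))
    -- Since j - 2 ≥ 1, a complete decomposition prescribes H(0) and H(1), so the first claim
    -- reduces to the second.
    exact not_decompositionStartsWith hj hf0 hf hgen hA θ fun a ha => hD a (by omega)
  · rintro ⟨n, φ, hφ⟩
    have := hfin φ hφ
    exact not_decompositionStartsWith hj hf0 hf hgen hA θ
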